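/- Let $(\Omega,\Sigma,\mu)$ be a complete probability space, let $1\le p<\infty$, and let $X$ be a real Banach space with topological dual $X^*$. Suppose that $X$ has Efremov's property $(\mathcal{E})$: for every convex bounded set $C\subseteq X^*$, every element of the $w^*$-closure of $C$ is the $w^*$-limit of a sequence contained in $C$. Let $\Gamma\subseteq X^*$ be $w^*$-thick, that is, whenever $\Gamma=\bigcup_{n\in\mathbb{N}}\Gamma_n$ for some increasing sequence of sets $(\Gamma_n)$, there is $n\in\mathbb{N}$ such that the $w^*$-closure of the absolutely convex hull of $\Gamma_n$ contains a norm ball of positive radius centred at $0$. Let $f:\Omega\to X$ be an arbitrary function (no scalar measurability is assumed) such that $\langle f,x^*\rangle\in L^p(\mu)$ for every $x^*\in\Gamma$, where $\langle f,x^*\rangle(\omega):=\langle f(\omega),x^*\rangle$. Then $f$ is $p$-Dunford integrable, that is, $\langle f,x^*\rangle\in L^p(\mu)$ for every $x^*\in X^*$. -/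

import Mathlib

open MeasureTheory Filter Topology

/-- Efremov's property `(E)` of a real normed space `X`: for every convex norm-bounded set
`C ⊆ X*`, every element of the weak-star closure of `C` is the weak-star limit of a sequence
contained in `C`. -/
def HasPropertyE (X : Type*) [NormedAddCommGroup X] [NormedSpace ℝ X] : Prop :=
  ∀ C : Set (StrongDual ℝ X), Convex ℝ C → Bornology.IsBounded C →
    ∀ x ∈ closure (StrongDual.toWeakDual '' C),
      ∃ u : ℕ → StrongDual ℝ X, (∀ n, u n ∈ C) ∧
        Tendsto (fun n => StrongDual.toWeakDual (u n)) atTop (𝓝 x)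

/-- A set `Γ ⊆ X*` is weak-star thick if whenever `Γ` is the union of an increasing sequence of
sets `Γ n`, there is `n` such that the weak-star closure of the absolutely convex hull of `Γ n`
contains a norm ball (of positive radius) centred at `0`. -/
def IsWeakStarThick {X : Type*} [NormedAddCommGroup X] [NormedSpace ℝ X]
    (Γ : Set (StrongDual ℝ X)) : Prop :=
  ∀ Γs : ℕ → Set (StrongDual ℝ X), Monotone Γs → Γ = ⋃ n, Γs n →
    ∃ n : ℕ, ∃ r : ℝ, 0 < r ∧
      StrongDual.toWeakDual '' Metric.ball (0 : StrongDual ℝ X) r ⊆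
        closure (StrongDual.toWeakDual '' absConvexHull ℝ (Γs n))

/-- A function `f : Ω → X` is `p`-Dunford integrable if the scalar function `ω ↦ ⟨f ω, x*⟩`
belongs to `L^p(μ)` for every `x* ∈ X*`. No measurability of `f` itself is required. -/
def IsPDunfordIntegrable {Ω : Type*} [MeasurableSpace Ω] {X : Type*} [NormedAddCommGroup X]
    [NormedSpace ℝ X] (f : Ω → X) (p : ENNReal) (μ : Measure Ω) : Prop :=
  ∀ x' : StrongDual ℝ X, MemLp (fun ω => x' (f ω)) p μ

/-! Let `T n` consist of the functionals for which both the norm and the `L^p` norm of the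
composition with `f` are at most `n`. The sets `Γ ∩ T n` exhaust `Γ`, so thickness puts a ball in
the weak-star closure of some absolutely convex hull, which stays inside `T n`. Property `(E)`
reaches each point of the ball by a sequence, not just a net, so Fatou's lemma applies; scaling does
the rest. -/

/-- The functionals of norm at most `c` whose composition with `f` has `L^p`-norm at most `c` form
an absolutely convex set. -/
theorem absConvex_norm_le_eLpNorm_le {Ω : Type*} [MeasurableSpace Ω] (μ : Measure Ω)
    {X : Type*} [NormedAddCommGroup X] [NormedSpace ℝ X] (p : ENNReal) (hp_one : 1 ≤ p)
    (f : Ω → X) (c : NNReal) :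
    AbsConvex ℝ {x' : StrongDual ℝ X | ‖x'‖ ≤ c ∧
      AEStronglyMeasurable (fun ω => x' (f ω)) μ ∧ eLpNorm (fun ω => x' (f ω)) p μ ≤ c} := by
  refine ⟨?_, ?_⟩
  · rw [balanced_iff_smul_mem]
    rintro a ha x ⟨h1, h2, h3⟩
    refine ⟨?_, h2.const_smul a, ?_⟩
    · rw [norm_smul]
      exact (mul_le_of_le_one_left (norm_nonneg _) ha).trans h1
    · refine (eLpNorm_const_smul_le (c := a) (f := fun ω => x (f ω))).trans ?_
      refine (mul_le_of_le_one_left zero_le ?_).trans h3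
      rw [enorm_eq_nnnorm]
      exact_mod_cast ha
  · rintro x ⟨hx1, hx2, hx3⟩ y ⟨hy1, hy2, hy3⟩ a b ha hb hab
    refine ⟨?_, (hx2.const_smul a).add (hy2.const_smul b), ?_⟩
    · have hx := mem_closedBall_zero_iff.2 hx1
      have hy := mem_closedBall_zero_iff.2 hy1
      exact mem_closedBall_zero_iff.1 (convex_closedBall (0 : StrongDual ℝ X) c hx hy ha hb hab)
    · calc eLpNorm (fun ω => (a • x + b • y) (f ω)) p μ
          ≤ eLpNorm (a • fun ω => x (f ω)) p μ + eLpNorm (b • fun ω => y (f ω)) p μ :=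
            eLpNorm_add_le (hx2.const_smul a) (hy2.const_smul b) hp_one
        _ ≤ ‖a‖ₑ * c + ‖b‖ₑ * c :=
            add_le_add (eLpNorm_const_smul_le.trans (by gcongr))
              (eLpNorm_const_smul_le.trans (by gcongr))
        _ = c := by
            rw [← add_mul, Real.enorm_eq_ofReal ha, Real.enorm_eq_ofReal hb,
              ← ENNReal.ofReal_add ha hb, hab, ENNReal.ofReal_one, one_mul]

/-- A pointwise limit of functions bounded in `L^p` belongs to `L^p`. -/
theorem memLp_of_tendsto_of_eLpNorm_le {Ω : Type*} [MeasurableSpace Ω] {μ : Measure Ω}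
    {p : ENNReal} {g : ℕ → Ω → ℝ} {h : Ω → ℝ} (c : NNReal)
    (hg : ∀ n, AEStronglyMeasurable (g n) μ) (hc : ∀ n, eLpNorm (g n) p μ ≤ c)
    (hlim : ∀ ω, Tendsto (fun n => g n ω) atTop (𝓝 (h ω))) : MemLp h p μ := by
  refine ⟨aestronglyMeasurable_of_tendsto_ae atTop hg (ae_of_all _ hlim), ?_⟩
  -- Fatou's lemma.
  refine lt_of_le_of_lt (Lp.eLpNorm_lim_le_liminf_eLpNorm hg h (ae_of_all _ hlim)) ?_
  exact lt_of_le_of_lt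
    ((liminf_le_liminf (Eventually.of_forall hc)).trans_eq (liminf_const _)) ENNReal.coe_lt_top

theorem corollary5p2 {Ω : Type*} [MeasurableSpace Ω] (μ : Measure Ω) [IsProbabilityMeasure μ]
    [μ.IsComplete] {X : Type*} [NormedAddCommGroup X] [NormedSpace ℝ X] [CompleteSpace X]
    (p : ENNReal) (hp_one : 1 ≤ p) (hp_top : p ≠ ⊤) (hX : HasPropertyE X) (f : Ω → X)
    (Γ : Set (StrongDual ℝ X)) (hΓ : IsWeakStarThick Γ)
    (hf : ∀ x' ∈ Γ, MemLp (fun ω => x' (f ω)) p μ) :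
    IsPDunfordIntegrable f p μ := by
  -- The bound on `‖x'‖` makes the hull norm-bounded, as property `(E)` requires.
  let T : ℕ → Set (StrongDual ℝ X) := fun n => {x' | ‖x'‖ ≤ (n : NNReal) ∧
    AEStronglyMeasurable (fun ω => x' (f ω)) μ ∧
      eLpNorm (fun ω => x' (f ω)) p μ ≤ (n : NNReal)}
  have hmono : Monotone T := by
    rintro m n hmn x ⟨h1, h2, h3⟩
    exact ⟨h1.trans (by exact_mod_cast hmn), h2, h3.trans (by exact_mod_cast hmn)⟩
  have hunion : Γ = ⋃ n, Γ ∩ T n := by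
    rw [← Set.inter_iUnion, eq_comm, Set.inter_eq_left]
    intro x hx
    obtain ⟨m, hm⟩ := exists_nat_ge ‖x‖
    obtain ⟨n, hn⟩ := ENNReal.exists_nat_gt (hf x hx).2.ne
    refine Set.mem_iUnion.2 ⟨max m n, ?_, (hf x hx).1, ?_⟩
    · exact hm.trans (by exact_mod_cast le_max_left m n)
    · exact hn.le.trans (by exact_mod_cast le_max_right m n)
  obtain ⟨n, r, hr, hball⟩ := hΓ (fun n => Γ ∩ T n)
    (fun m n hmn => Set.inter_subset_inter_right _ (hmono hmn)) hunion
  have hsub : absConvexHull ℝ (Γ ∩ T n) ⊆ T n :=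
    absConvexHull_min Set.inter_subset_right (absConvex_norm_le_eLpNorm_le μ p hp_one f n)
  have hbdd : Bornology.IsBounded (absConvexHull ℝ (Γ ∩ T n)) :=
    Metric.isBounded_closedBall.subset fun x hx => mem_closedBall_zero_iff.2 (hsub hx).1
  have hmem : ∀ x ∈ Metric.ball (0 : StrongDual ℝ X) r, MemLp (fun ω => x (f ω)) p μ := by
    intro x hx
    obtain ⟨u, hu, hlim⟩ := hX _ absConvex_absConvexHull.2 hbdd _
      (hball (Set.mem_image_of_mem _ hx))
    exact memLp_of_tendsto_of_eLpNorm_le n (fun k => (hsub (hu k)).2.1)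
      (fun k => (hsub (hu k)).2.2)
      fun ω => ((WeakDual.eval_continuous (f ω)).tendsto _).comp hlim
  intro x
  obtain ⟨a, ha, hax⟩ : ∃ a : ℝ, a ≠ 0 ∧ a • x ∈ Metric.ball (0 : StrongDual ℝ X) r := by
    -- The `+ 1` covers `x = 0` and makes the norm strictly less than `r`.
    refine ⟨r / (‖x‖ + 1), by positivity, ?_⟩
    rw [mem_ball_zero_iff, norm_smul, Real.norm_of_nonneg (by positivity), div_mul_eq_mul_div,
      div_lt_iff₀ (by positivity)]
    nlinarith
  have h := (hmem _ hax).const_smul a⁻¹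
  simpa [Pi.smul_def, ha] using h
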